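/- Let $M$ be an integral Deligne--Mumford stack of finite type over a field $k$ (with quasi-compact separated diagonal), and let $R=[\mathscr R_0\xrightarrow{d}\mathscr R_1]$ be a complex of locally free sheaves of finite rank on $M$, in degrees $0$ and $1$, such that $H^1(R)=\operatorname{coker} d$ is a torsion sheaf and the image sheaf of $d$ is locally free. Let $h^1/h^0(R^\vee[-1])=[\mathscr R_0^\vee/\mathscr R_1^\vee]$ be the associated bundle stack over $M$ (the quotient of the vector bundle $\mathscr R_0^\vee$ by the action of the vector bundle $\mathscr R_1^\vee$ through $d^\vee$), let $U\subset M$ be the complement of the support of $H^1(R)$, and let $\mathbf B\subset h^1/h^0(R^\vee[-1])$ be the closure of the zero section of $h^1/h^0(R^\vee[-1])|_U=H^0(R|_U)^\vee$. Then $H^0(R)=\ker d$ is locally free and $$0^![\mathbf B]=e\bigl(H^0(R)^\vee\bigr)\in A_*M .$$ Here $A_*M$ is the Chow group with coefficients in an arbitrary commutative ring $\Lambda$, in the form $A_*M=\varinjlim_E Z_*(E)_\Lambda/{\sim_{\mathrm{rat}}}$, where $E$ runs over the vector bundles on $M$ and the transition maps are the flat pullbacks along surjections of vector bundles, all of which are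 identified (for $\Lambda=\mathbb Q$ this is the usual group of cycles on $M$ modulo rational equivalence). For a vector bundle $E$ on $M$, $0^!\colon Z_*(E)\to A_*M$ is the Gysin map of the zero section, that is, the canonical map to the colimit (the inverse of flat pullback); for the bundle stack, $0^!$ is the flat pullback $Z_*([\mathscr R_0^\vee/\mathscr R_1^\vee])\to Z_*(\mathscr R_0^\vee)$ followed by the Gysin map of $\mathscr R_0^\vee$; and $e(E)=0^![0_E]$ is the Euler class, the self-intersection of the zero section $0_E\subset E$. -/

import Mathlib

open CategoryTheory Limits Opposite AlgebraicGeometry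

universe w' v' w v u

/-! ### Ringed charts, closed substacks and cycles

`O : D ⥤ CommRingCat` records the affine étale charts `Spec (O.obj X)` of a Deligne-Mumford
stack `M`, with the (étale) morphisms over `M` between them. All geometry over `M` is
described on these charts. -/

/-- A stack over `M` given on every affine étale chart `X` of `M` by a groupoid of affine schemes
`Spec (rel X) ⇉ Spec (atlas X)` (smooth in all uses below). -/
structure StackPresentation (D : Type w) [Category.{v} D] where
  atlas : D ⥤ CommRingCat.{u}
  rel : D ⥤ CommRingCat.{u}
  s : atlas ⟶ rel
  t : atlas ⟶ rel

/-- The stack whose étale charts are the schemes `Spec (A.obj X)` themselves. -/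
abbrev StackPresentation.ofCharts {D : Type w} [Category.{v} D] (A : D ⥤ CommRingCat.{u}) :
    StackPresentation.{w, v, u} D where
  atlas := A
  rel := A
  s := 𝟙 A
  t := 𝟙 A

/-- A closed (reduced) substack: on every chart a closed subset of the atlas, compatible
with the morphisms of charts and stable under the groupoid. -/
@[ext] structure ClosedSubstack {D : Type w} [Category.{v} D]
    (P : StackPresentation.{w, v, u} D) where
  carrier : ∀ X : D, Set (PrimeSpectrum (P.atlas.obj X))
  isClosed : ∀ X, IsClosed (carrier X)
  preimage_map : ∀ {X Y : D} (g : X ⟶ Y),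
    PrimeSpectrum.comap (P.atlas.map g).hom ⁻¹' carrier X = carrier Y
  invariant : ∀ X, PrimeSpectrum.comap (P.s.app X).hom ⁻¹' carrier X =
    PrimeSpectrum.comap (P.t.app X).hom ⁻¹' carrier X

namespace ClosedSubstack

variable {D : Type w} [Category.{v} D] {P : StackPresentation.{w, v, u} D}

instance : PartialOrder (ClosedSubstack P) :=
  PartialOrder.lift carrier (fun _ _ h => ClosedSubstack.ext h)

/-- Irreducibility (equivalently, as closed substacks are taken reduced, integrality). -/
def IsIrreducible (Z : ClosedSubstack P) : Prop :=
  (∃ X, (Z.carrier X).Nonempty) ∧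
  ∀ Z₁ Z₂ : ClosedSubstack P, (∀ X, Z.carrier X ⊆ Z₁.carrier X ∪ Z₂.carrier X) →
    Z ≤ Z₁ ∨ Z ≤ Z₂

/-- The whole stack. -/
def whole (P : StackPresentation.{w, v, u} D) : ClosedSubstack P where
  carrier _ := Set.univ
  isClosed _ := isClosed_univ
  preimage_map _ := rfl
  invariant _ := rfl

/-- The closure of a set of points: the smallest closed substack containing it. -/
def closure (P : StackPresentation.{w, v, u} D)
    (S : ∀ X : D, Set (PrimeSpectrum (P.atlas.obj X))) : ClosedSubstack P where
  carrier X := ⋂ Z ∈ {Z : ClosedSubstack P | ∀ Y, S Y ⊆ Z.carrier Y}, Z.carrier X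
  isClosed X := isClosed_biInter fun Z _ => Z.isClosed X
  preimage_map g := by
    simp only [Set.preimage_iInter]
    exact Set.iInter₂_congr fun Z _ => Z.preimage_map g
  invariant X := by
    simp only [Set.preimage_iInter]
    exact Set.iInter₂_congr fun Z _ => Z.invariant X

/-- The preimage `b⁻¹(Z)` of a closed substack under the atlas `b` of a presented stack. -/
def toAtlas (Z : ClosedSubstack P) :
    ClosedSubstack (StackPresentation.ofCharts P.atlas) where
  carrier := Z.carrier
  isClosed := Z.isClosed
  preimage_map := Z.preimage_map
  invariant _ := rfl

/-- The preimage `p⁻¹(Z)` under the morphism `p` given on charts by `φ : A ⟶ A'`. -/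
def preimage {A A' : D ⥤ CommRingCat.{u}} (φ : A ⟶ A')
    (Z : ClosedSubstack (StackPresentation.ofCharts A)) :
    ClosedSubstack (StackPresentation.ofCharts A') where
  carrier X := PrimeSpectrum.comap (φ.app X).hom ⁻¹' Z.carrier X
  isClosed X := (Z.isClosed X).preimage (PrimeSpectrum.continuous_comap (φ.app X).hom)
  preimage_map {X Y} g := by
    have h := Z.preimage_map g
    dsimp only at h ⊢
    rw [← h, ← Set.preimage_comp, ← Set.preimage_comp]
    have e : (A'.map g).hom.comp (φ.app X).hom = (φ.app Y).hom.comp (A.map g).hom := by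
      rw [← CommRingCat.hom_comp, ← CommRingCat.hom_comp, φ.naturality]
    ext q
    simp only [Set.mem_preimage, Function.comp_apply, ← PrimeSpectrum.comap_comp_apply, e]
  invariant _ := rfl

end ClosedSubstack

/-- Integral closed substacks. -/
abbrev IntegralSubstack {D : Type w} [Category.{v} D] (P : StackPresentation.{w, v, u} D) :=
  {Z : ClosedSubstack P // Z.IsIrreducible}

/-- The group of cycles `Z_*` with coefficients in `Λ`. -/
abbrev Cycles (Λ : Type w') [CommRing Λ] {D : Type w} [Category.{v} D]
    (P : StackPresentation.{w, v, u} D) := IntegralSubstack P →₀ Λ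

/-- The cycle `[Z]` of a closed substack with its reduced structure: the sum of
its irreducible components. -/
noncomputable def ClosedSubstack.cycle (Λ : Type w') [CommRing Λ] {D : Type w} [Category.{v} D]
    {P : StackPresentation.{w, v, u} D} (Z : ClosedSubstack P) : Cycles Λ P :=
  ∑ᶠ (W : IntegralSubstack P)
    (_ : Maximal (fun W' : ClosedSubstack P => W'.IsIrreducible ∧ W' ≤ Z) W.1),
    Finsupp.single W 1

/-! ### Rational equivalence -/

section RationalEquivalence

variable {D : Type w} [Category.{v} D] {A : D ⥤ CommRingCat.{u}}

/-- The coordinate ring of the reduced closed subscheme `Y ∩ Spec (A.obj X)`. -/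
abbrev ClosedSubstack.coordRing (Y : ClosedSubstack (StackPresentation.ofCharts A)) (X : D) :
    Type u :=
  A.obj X ⧸ PrimeSpectrum.vanishingIdeal (Y.carrier X)

/-- A nonzero rational function on `Y`, written on each étale chart as a fraction `num / den` of
nonzerodivisors, the fractions being compatible with the morphisms of charts. -/
structure RationalFunction (Y : ClosedSubstack (StackPresentation.ofCharts A)) where
  num : ∀ X : D, A.obj X
  den : ∀ X : D, A.obj X
  num_mem : ∀ X, (Ideal.Quotient.mk _ (num X) : Y.coordRing X) ∈ nonZeroDivisors (Y.coordRing X)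
  den_mem : ∀ X, (Ideal.Quotient.mk _ (den X) : Y.coordRing X) ∈ nonZeroDivisors (Y.coordRing X)
  compat : ∀ {X X' : D} (g : X ⟶ X'),
    (Ideal.Quotient.mk _ ((A.map g).hom (num X) * den X') : Y.coordRing X') =
      Ideal.Quotient.mk _ (num X' * (A.map g).hom (den X))

/-- The order of vanishing of a rational function along the prime `p` of `Y` on the chart `X`
(used for `p` of height one), i.e. `length (O_p / num) - length (O_p / den)`. -/
noncomputable def RationalFunction.ordAt {Y : ClosedSubstack (StackPresentation.ofCharts A)}
    (f : RationalFunction Y) (X : D) (p : PrimeSpectrum (Y.coordRing X)) : ℤ :=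
  ((Ring.ord (Localization.AtPrime p.asIdeal)
      (algebraMap (Y.coordRing X) _ (Ideal.Quotient.mk _ (f.num X)))).toNat : ℤ) -
    ((Ring.ord (Localization.AtPrime p.asIdeal)
      (algebraMap (Y.coordRing X) _ (Ideal.Quotient.mk _ (f.den X)))).toNat : ℤ)

open Classical in
/-- The multiplicity of a cycle at a point `q` of the chart `X`: the sum of the coefficients of
those components which have `q` as a generic point on this chart. -/
noncomputable def cycleMult (c : IntegralSubstack (StackPresentation.ofCharts A) →₀ ℤ) (X : D)
    (q : PrimeSpectrum (A.obj X)) : ℤ :=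
  c.sum fun W n => if Minimal (fun q' => q' ∈ W.1.carrier X) q then n else 0

open Classical in
/-- `c` is the divisor of the rational function `f` on the integral closed substack `Y`; this is
tested at all points of all étale charts. -/
def IsDivisorOf {Y : ClosedSubstack (StackPresentation.ofCharts A)} (f : RationalFunction Y)
    (c : IntegralSubstack (StackPresentation.ofCharts A) →₀ ℤ) : Prop :=
  (∀ W ∈ c.support, W.1 ≤ Y) ∧
  ∀ (X : D) (p : PrimeSpectrum (Y.coordRing X)),
    cycleMult c X (PrimeSpectrum.comap (Ideal.Quotient.mk _) p) =
      if p.asIdeal.height = 1 then f.ordAt X p else 0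

/-- The cycles `div f`, for `f` a nonzero rational function on an integral closed substack. -/
def principalCycles (A : D ⥤ CommRingCat.{u}) :
    Set (IntegralSubstack (StackPresentation.ofCharts A) →₀ ℤ) :=
  {c | ∃ (Y : IntegralSubstack (StackPresentation.ofCharts A)) (f : RationalFunction Y.1),
    IsDivisorOf f c}

end RationalEquivalence

/-! ### Sheaves of modules and vector bundles -/

/-- A sheaf of modules, given by its sections on all affine charts. -/
structure ModuleSheaf {D : Type w} [Category.{v} D] (O : D ⥤ CommRingCat.{u}) where
  obj : D → Type u
  [addCommGroup : ∀ X, AddCommGroup (obj X)]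
  [module : ∀ X, Module (O.obj X) (obj X)]
  map : ∀ {X Y : D} (g : X ⟶ Y), obj X →ₛₗ[(O.map g).hom] obj Y
  map_id : ∀ (X : D) (m : obj X), map (𝟙 X) m = m
  map_comp : ∀ {X Y Z : D} (g : X ⟶ Y) (h : Y ⟶ Z) (m : obj X), map (g ≫ h) m = map h (map g m)

attribute [instance] ModuleSheaf.addCommGroup ModuleSheaf.module

/-- The ring homomorphism of symmetric algebras induced by a semilinear map. -/
noncomputable def symMap {A B : Type u} [CommRing A] [CommRing B] {σ : A →+* B} {M N : Type u}
    [AddCommGroup M] [AddCommGroup N] [Module A M] [Module B N] (l : M →ₛₗ[σ] N) :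
    SymmetricAlgebra A M →+* SymmetricAlgebra B N :=
  letI : Algebra A (SymmetricAlgebra B N) := ((algebraMap B (SymmetricAlgebra B N)).comp σ).toAlgebra
  (SymmetricAlgebra.lift (R := A) (A := SymmetricAlgebra B N)
    { toFun := fun m => SymmetricAlgebra.ι B N (l m)
      map_add' := fun m m' => by simp
      map_smul' := fun a m => by
        rw [l.map_smulₛₗ, map_smul, Algebra.smul_def, Algebra.smul_def]
        rfl }).toRingHom

section symMap

variable {A B C : Type u} [CommRing A] [CommRing B] [CommRing C] {σ : A →+* B} {τ : B →+* C}
  {M N Q : Type u} [AddCommGroup M] [AddCommGroup N] [AddCommGroup Q]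
  [Module A M] [Module B N] [Module C Q]

@[simp] theorem symMap_ι (l : M →ₛₗ[σ] N) (m : M) :
    symMap l (SymmetricAlgebra.ι A M m) = SymmetricAlgebra.ι B N (l m) := by
  let _ : Algebra A (SymmetricAlgebra B N) := ((algebraMap B (SymmetricAlgebra B N)).comp σ).toAlgebra
  exact SymmetricAlgebra.lift_ι_apply (R := A) (A := SymmetricAlgebra B N) _ m

@[simp] theorem symMap_algebraMap (l : M →ₛₗ[σ] N) (a : A) :
    symMap l (algebraMap A _ a) = algebraMap B _ (σ a) := by
  let _ : Algebra A (SymmetricAlgebra B N) := ((algebraMap B (SymmetricAlgebra B N)).comp σ).toAlgebra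
  exact AlgHom.commutes (SymmetricAlgebra.lift (R := A) (A := SymmetricAlgebra B N) _) a

theorem symRingHom_ext {S : Type u} [CommRing S] {f g : SymmetricAlgebra A M →+* S}
    (h₁ : ∀ a, f (algebraMap A _ a) = g (algebraMap A _ a))
    (h₂ : ∀ m, f (SymmetricAlgebra.ι A M m) = g (SymmetricAlgebra.ι A M m)) : f = g := by
  refine RingHom.ext fun z => ?_
  induction z using SymmetricAlgebra.induction with
  | algebraMap r => exact h₁ r
  | ι x => exact h₂ x
  | mul a b ha hb => rw [map_mul, map_mul, ha, hb]
  | add a b ha hb => rw [map_add, map_add, ha, hb]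

end symMap

namespace ModuleSheaf

variable {D : Type w} [Category.{v} D] {O : D ⥤ CommRingCat.{u}}

/-- Locally free of finite rank: finite projective on every affine chart and compatible with
base change along morphisms of charts. -/
structure IsLocallyFree (E : ModuleSheaf O) : Prop where
  finite : ∀ X, Module.Finite (O.obj X) (E.obj X)
  projective : ∀ X, Module.Projective (O.obj X) (E.obj X)
  baseChange : ∀ {X Y : D} (g : X ⟶ Y),
    letI : Algebra (O.obj X) (O.obj Y) := (O.map g).hom.toAlgebra
    letI : Module (O.obj X) (E.obj Y) := Module.compHom (E.obj Y) (O.map g).hom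
    haveI : IsScalarTower (O.obj X) (O.obj Y) (E.obj Y) := ⟨fun _ b m => mul_smul _ b m⟩
    IsBaseChange (O.obj Y)
      ({ toFun := E.map g
         map_add' := map_add _
         map_smul' := fun a m => (E.map g).map_smulₛₗ a m } : E.obj X →ₗ[O.obj X] E.obj Y)

/-- Homomorphisms of sheaves of modules. -/
structure Hom (E E' : ModuleSheaf O) where
  app : ∀ X, E.obj X →ₗ[O.obj X] E'.obj X
  naturality : ∀ {X Y : D} (g : X ⟶ Y) (m : E.obj X), app Y (E.map g m) = E'.map g (app X m)

/-- The kernel sheaf. -/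
def ker {E E' : ModuleSheaf O} (β : Hom E E') : ModuleSheaf O where
  obj X := LinearMap.ker (β.app X)
  map g :=
    { toFun := fun m => ⟨E.map g m.1, by
        rw [LinearMap.mem_ker, β.naturality, LinearMap.mem_ker.1 m.2, map_zero]⟩
      map_add' := fun m m' => Subtype.ext (map_add (E.map g) m.1 m'.1)
      map_smul' := fun a m => Subtype.ext ((E.map g).map_smulₛₗ a m.1) }
  map_id X m := Subtype.ext (E.map_id X m.1)
  map_comp g h m := Subtype.ext (E.map_comp g h m.1)

/-- The image sheaf. -/
def image {E E' : ModuleSheaf O} (β : Hom E E') : ModuleSheaf O where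
  obj X := LinearMap.range (β.app X)
  map g :=
    { toFun := fun m => ⟨E'.map g m.1, by
        obtain ⟨_, n, rfl⟩ := m
        exact ⟨E.map g n, β.naturality g n⟩⟩
      map_add' := fun m m' => Subtype.ext (map_add (E'.map g) m.1 m'.1)
      map_smul' := fun a m => Subtype.ext ((E'.map g).map_smulₛₗ a m.1) }
  map_id X m := Subtype.ext (E'.map_id X m.1)
  map_comp g h m := Subtype.ext (E'.map_comp g h m.1)

/-- The sections of the cokernel sheaf on an affine chart. -/
abbrev coker {E E' : ModuleSheaf O} (β : Hom E E') (X : D) : Type u :=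
  E'.obj X ⧸ LinearMap.range (β.app X)

/-- The direct sum of two sheaves. -/
def prod (E E' : ModuleSheaf O) : ModuleSheaf O where
  obj X := E.obj X × E'.obj X
  map g :=
    { toFun := fun m => (E.map g m.1, E'.map g m.2)
      map_add' := fun m m' => by simp
      map_smul' := fun a m => by simp [LinearMap.map_smulₛₗ] }
  map_id X m := Prod.ext (E.map_id X m.1) (E'.map_id X m.2)
  map_comp g h m := Prod.ext (E.map_comp g h m.1) (E'.map_comp g h m.2)

/-- The coordinate rings `Sym (E X)` of the total space of the bundle dual to `E`: maps
`Sym (E X) → T` of algebras are the `T`-points of the bundle `E^∨`. -/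
noncomputable abbrev dualTotal (E : ModuleSheaf O) : D ⥤ CommRingCat.{u} where
  obj X := CommRingCat.of (SymmetricAlgebra (O.obj X) (E.obj X))
  map g := CommRingCat.ofHom (symMap (E.map g))
  map_id X := by
    ext1
    refine symRingHom_ext (fun a => ?_) (fun m => ?_)
    · simp
    · simp [E.map_id]
  map_comp g h := by
    ext1
    refine symRingHom_ext (fun a => ?_) (fun m => ?_)
    · simp
    · simp [E.map_comp]

/-- A homomorphism `E → E'` induces the bundle homomorphism `E'^∨ → E^∨`, given on charts
by `Sym E → Sym E'`. -/
noncomputable def Hom.dualMap {E E' : ModuleSheaf O} (β : Hom E E') : E.dualTotal ⟶ E'.dualTotal where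
  app X := CommRingCat.ofHom (symMap (β.app X))
  naturality {X Y} g := by
    ext1
    refine symRingHom_ext (fun a => ?_) (fun m => ?_)
    · change symMap (β.app Y) (symMap (E.map g) _) = symMap (E'.map g) (symMap (β.app X) _)
      simp
    · change symMap (β.app Y) (symMap (E.map g) _) = symMap (E'.map g) (symMap (β.app X) _)
      simp [β.naturality]

/-- The dual homomorphism `E'^∨ → E^∨` is a surjection of vector bundles. -/
def Hom.DualSurjective {E E' : ModuleSheaf O} (β : Hom E E') : Prop :=
  ∀ X, Function.Surjective (β.app X).dualMap

/-- The points of the total space of `E^∨` lying on the zero section over the subset `U` of the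
base. -/
def zeroSectionPoints (E : ModuleSheaf O) (U : ∀ X : D, Set (PrimeSpectrum (O.obj X))) (X : D) :
    Set (PrimeSpectrum (E.dualTotal.obj X)) :=
  PrimeSpectrum.comap
    (SymmetricAlgebra.algebraMapInv :
      SymmetricAlgebra (O.obj X) (E.obj X) →ₐ[O.obj X] O.obj X).toRingHom '' U X

end ModuleSheaf

/-- A vector bundle on `M`, represented by the locally free sheaf `E` of which the bundle is
the dual `E^∨`. -/
abbrev VBundle {D : Type w} [Category.{v} D] (O : D ⥤ CommRingCat.{u}) :=
  {E : ModuleSheaf O // E.IsLocallyFree}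

/-- The total space of the vector bundle `E^∨`. -/
noncomputable abbrev VBundle.total {D : Type w} [Category.{v} D] {O : D ⥤ CommRingCat.{u}}
    (E : VBundle O) : StackPresentation.{w, v, u} D :=
  StackPresentation.ofCharts E.1.dualTotal

/-! ### The Chow group, Gysin maps and the Euler class -/

section Chow

variable (Λ : Type w') [CommRing Λ] {D : Type w} [Category.{v} D] (O : D ⥤ CommRingCat.{u})

/-- Cycles on all vector bundles over `M`. -/
noncomputable abbrev BundleCycles := (Σ E : VBundle O, IntegralSubstack E.total) →₀ Λ

/-- A cycle on the total space of one vector bundle. -/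
noncomputable def bundleCycle {O : D ⥤ CommRingCat.{u}} (E : VBundle O) :
    Cycles Λ E.total →ₗ[Λ] BundleCycles Λ O :=
  Finsupp.lmapDomain Λ Λ (fun Z => (⟨E, Z⟩ : Σ E : VBundle O, IntegralSubstack E.total))

/-- The relations defining the Chow group: rational equivalence on each vector bundle, and
`[Z] = p^*[Z] = [p⁻¹(Z)]` for each surjection `p : E^∨ → G^∨` of vector bundles. -/
noncomputable def chowRelations : Submodule Λ (BundleCycles Λ O) :=
  Submodule.span Λ
    ({r | ∃ (E : VBundle O), ∃ c ∈ principalCycles E.1.dualTotal,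
        r = bundleCycle Λ E (c.mapRange (Int.cast : ℤ → Λ) Int.cast_zero)} ∪
     {r | ∃ (G E : VBundle O) (i : ModuleSheaf.Hom G.1 E.1) (_ : i.DualSurjective)
        (Z : IntegralSubstack G.total),
        r = bundleCycle Λ G (Finsupp.single Z 1) -
          bundleCycle Λ E ((Z.1.preimage i.dualMap).cycle Λ)})

/-- The Chow group `A_* M` of a Deligne-Mumford stack with coefficients in `Λ`: the colimit, over
the vector bundles `E → M` and the flat pullbacks along bundle surjections, of the groups of cycles
on `E` modulo rational equivalence. With rational coefficients all flat pullbacks are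
isomorphisms and this is the group of cycles on `M` modulo rational equivalence. -/
noncomputable abbrev ChowGroup := BundleCycles Λ O ⧸ chowRelations Λ O

variable {O}

/-- The Gysin map `0^!` of the vector bundle `E^∨`, intersection with its zero section, i.e. the
inverse of flat pullback from `M`. -/
noncomputable def bundleGysin (E : VBundle O) : Cycles Λ E.total →ₗ[Λ] ChowGroup Λ O :=
  (chowRelations Λ O).mkQ ∘ₗ bundleCycle Λ E

/-- The zero section of the vector bundle `E^∨`. -/
noncomputable def VBundle.zeroSection (E : VBundle O) : ClosedSubstack E.total :=
  ClosedSubstack.closure E.total (E.1.zeroSectionPoints fun _ => Set.univ)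

/-- The Euler class `e(E^∨) = 0^![0]`, the self-intersection of the zero section. -/
noncomputable def eulerClassDual (E : VBundle O) : ChowGroup Λ O :=
  bundleGysin Λ E (E.zeroSection.cycle Λ)

end Chow

/-! ### The bundle stack of a two-term complex -/

/-- A complex `[R₀ → R₁]` of locally free sheaves, in degrees `0` and `1`. -/
structure TwoTermComplex {D : Type w} [Category.{v} D] (O : D ⥤ CommRingCat.{u}) where
  R₀ : VBundle O
  R₁ : VBundle O
  d : ModuleSheaf.Hom R₀.1 R₁.1

namespace TwoTermComplex

variable {D : Type w} [Category.{v} D] {O : D ⥤ CommRingCat.{u}} (R : TwoTermComplex O)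

/-- The sheaf `H⁰(R)`. -/
abbrev H0 : ModuleSheaf O := ModuleSheaf.ker R.d

/-- The sections of `H¹(R)` on an affine chart. -/
abbrev H1 (X : D) : Type u := ModuleSheaf.coker R.d X

/-- `r ↦ (r, 0)`; dually, the projection `R₀^∨ × R₁^∨ → R₀^∨`. -/
def source : ModuleSheaf.Hom R.R₀.1 (R.R₀.1.prod R.R₁.1) where
  app _ := LinearMap.inl _ _ _
  naturality g _ := Prod.ext rfl (map_zero (R.R₁.1.map g)).symm

/-- `r ↦ (r, d r)`; dually, the action `(e, f) ↦ e + d^∨ f` of `R₁^∨` on `R₀^∨`. -/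
def target : ModuleSheaf.Hom R.R₀.1 (R.R₀.1.prod R.R₁.1) where
  app X := LinearMap.prod LinearMap.id (R.d.app X)
  naturality g m := Prod.ext rfl (R.d.naturality g m)

/-- The bundle stack `h¹/h⁰(R^∨[-1]) = [R₀^∨ / R₁^∨]`, the quotient stack for the action of `R₁^∨`
on `R₀^∨` by translation through `d^∨`. -/
noncomputable def bundleStack : StackPresentation.{w, v, u} D where
  atlas := R.R₀.1.dualTotal
  rel := (R.R₀.1.prod R.R₁.1).dualTotal
  s := R.source.dualMap
  t := R.target.dualMap

/-- The complement `U` of the support of `H¹(R)`. -/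
def vanishingOpen (X : D) : Set (PrimeSpectrum (O.obj X)) :=
  (Module.support (O.obj X) (R.H1 X))ᶜ

/-- The closure in the bundle stack of its zero section over `U`. -/
noncomputable def zeroClosure : ClosedSubstack R.bundleStack :=
  ClosedSubstack.closure R.bundleStack (R.R₀.1.zeroSectionPoints R.vanishingOpen)

/-- The Gysin map `0^!` of the bundle stack: flat pullback along the atlas `b : R₀^∨ → [R₀^∨ / R₁^∨]`
followed by the Gysin map of the vector bundle `R₀^∨`. -/
noncomputable def gysin (Λ : Type w') [CommRing Λ] :
    Cycles Λ R.bundleStack →ₗ[Λ] ChowGroup Λ O :=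
  Finsupp.linearCombination Λ fun Z => bundleGysin Λ R.R₀ (Z.1.toAtlas.cycle Λ)

end TwoTermComplex

/-! ### Deligne-Mumford stacks -/

section Stacks

open Pseudofunctor Pseudofunctor.CoGrothendieck Bicategory

variable {k : Type u} [Field k]

/-- A category fibred over the category of schemes over `k`, as a pseudofunctor. An object `x` of
its total category `∫ᶜ F` is a scheme with an object of `F` over it, that is, a morphism
from this scheme to `F`. -/
abbrev PseudofunctorOverField (k : Type u) [Field k] :=
  LocallyDiscrete (Over (Spec (CommRingCat.of k)))ᵒᵖ ⥤ᵖ Cat.{v', w'}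

/-- The morphism of schemes underlying a morphism of the total category. -/
noncomputable abbrev baseMap {F : PseudofunctorOverField.{w', v'} k} {W x : ∫ᶜ F} (a : W ⟶ x) :
    W.base.left ⟶ x.base.left :=
  ((forget F).map a).left

/-- `x : X → F` and `y : Y → F` have the scheme `W` as 2-fibre product `X ×_F Y`. For `F` fibred in
groupoids this says that `W`, with the object induced from `x`, is the product of `x` and `y` in the
total category, as a morphism from `t : T → F` to `x` is a morphism `a : T → X` with
an isomorphism `t ≅ a^* x`. -/
def IsFibreProduct {F : PseudofunctorOverField.{w', v'} k} {x y W : ∫ᶜ F}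
    (a : W ⟶ x) (b : W ⟶ y) : Prop :=
  Nonempty (IsLimit (BinaryFan.mk a b))

/-- The morphism `X ×_F Y → X ×_k Y`, the base change of the diagonal of `F`. -/
noncomputable def toProduct {F : PseudofunctorOverField.{w', v'} k} {x y W : ∫ᶜ F}
    (a : W ⟶ x) (b : W ⟶ y) : W.base.left ⟶ pullback x.base.hom y.base.hom :=
  pullback.lift (baseMap a) (baseMap b)
    ((Over.w ((forget F).map a)).trans (Over.w ((forget F).map b)).symm)

/-- The morphism `x : X → F` is étale: so is `X ×_F Y → Y` for every `Y → F`. -/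
def IsEtaleOver {F : PseudofunctorOverField.{w', v'} k} (x : ∫ᶜ F) : Prop :=
  ∀ (y W : ∫ᶜ F) (a : W ⟶ x) (b : W ⟶ y), IsFibreProduct a b → Etale (baseMap b)

/-- The morphism `x : X → F` is surjective: so is `X ×_F Y → Y` for every `Y → F`. -/
def IsSurjectiveOver {F : PseudofunctorOverField.{w', v'} k} (x : ∫ᶜ F) : Prop :=
  ∀ (y W : ∫ᶜ F) (a : W ⟶ x) (b : W ⟶ y), IsFibreProduct a b → Surjective (baseMap b)

/-- A Deligne-Mumford stack of finite type over the field `k`: a stack in groupoids for the étale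
topology, whose diagonal is representable, quasi-compact and separated, and which has an étale
surjection from an affine scheme of finite type over `k`. (A representable, quasi-compact and
separated diagonal of such a stack is automatically representable by schemes.) -/
class IsDeligneMumford (F : PseudofunctorOverField.{w', v'} k) : Prop extends
    F.IsStack (Scheme.etaleTopology.{u}.over (Spec (CommRingCat.of k))) where
  isGroupoid : ∀ X, IsGroupoid (F.obj X)
  representable_diagonal : ∀ x y : ∫ᶜ F, ∃ (W : ∫ᶜ F) (a : W ⟶ x) (b : W ⟶ y), IsFibreProduct a b
  quasiCompact_diagonal : ∀ (x y W : ∫ᶜ F) (a : W ⟶ x) (b : W ⟶ y), IsFibreProduct a b →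
    QuasiCompact (toProduct a b)
  separated_diagonal : ∀ (x y W : ∫ᶜ F) (a : W ⟶ x) (b : W ⟶ y), IsFibreProduct a b →
    IsSeparated (toProduct a b)
  exists_atlas : ∃ x : ∫ᶜ F, IsAffine x.base.left ∧
    LocallyOfFiniteType x.base.hom ∧ IsEtaleOver x ∧ IsSurjectiveOver x

/-- The category of affine étale charts `X → F`. -/
abbrev EtaleChart (F : PseudofunctorOverField.{w', v'} k) :=
  ObjectProperty.FullSubcategory fun x : ∫ᶜ F =>
    IsAffine x.base.left ∧ IsEtaleOver x

/-- The structure sheaf of `F` on its affine étale charts. -/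
noncomputable abbrev structureSheafOf (F : PseudofunctorOverField.{w', v'} k) :
    (EtaleChart F)ᵒᵖ ⥤ CommRingCat.{u} :=
  (ObjectProperty.ι _ ⋙ forget F ⋙ Over.forget _).op ⋙ Scheme.Γ

/-- The stack is integral: reduced (that is, its étale charts are reduced) and irreducible. -/
structure IsIntegralStack (F : PseudofunctorOverField.{w', v'} k) : Prop where
  reduced : ∀ X : (EtaleChart F)ᵒᵖ, IsReduced ((structureSheafOf F).obj X)
  irreducible :
    (ClosedSubstack.whole (StackPresentation.ofCharts (structureSheafOf F))).IsIrreducible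

end Stacks

/-!
Write `p : R₀^∨ → H⁰(R)^∨` for the bundle map dual to the inclusion `H⁰(R) ⊆ R₀`. As the image
of `d` is locally free, `R₀` is an extension of locally free sheaves that splits on every chart.
Hence `H⁰(R)` is locally free (`ModuleSheaf.IsLocallyFree.ker`) and `p` is a surjection of vector
bundles, so that the Chow group identifies the zero section of `H⁰(R)^∨` with its flat pullback
`p⁻¹(0)`. It remains to see that `p⁻¹(0)`, the zero locus of `H⁰(R)` in `R₀^∨`, is the
preimage of `𝐁` under the atlas (`TwoTermComplex.zeroClosure_eq`), and that both
`𝐁` and the zero section are irreducible, so that their cycles have a single term.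

The zero locus is invariant under translation by `R₁^∨` and contains the zero section, so it
contains `𝐁`. Conversely, an invariant closed substack `Z` containing the zero section over `U` contains
the image of `R₁^∨|_U` under `d^∨`. Over `U` the map `d` is onto, and this image is the whole zero
locus (`exists_comap_symMap_eq`). The zero locus is flat over `M`, so by going down all of its
points are specializations of points over minimal primes of charts, and these primes lie in `U` because
`H¹(R)` is torsion. Thus `Z` contains the zero locus (`TwoTermComplex.zeroLocusH0_le`).

Given two closed substacks covering `𝐁`, their restrictions to the zero section cover `M`; since `M`
is irreducible, one of them contains the zero section, and then all of `𝐁`. This avoids any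
study of the components of vector bundles.
-/

/-! ### Kernels and base change -/

/-- Base change passes to the kernel of a split surjection: only a retraction of `i` is needed, no
flatness of `B` over `A`. -/
theorem isBaseChange_of_split_exact {A B : Type*} [CommRing A] [CommRing B] [Algebra A B]
    {M₁ M₂ M₃ N₁ N₂ N₃ : Type*} [AddCommGroup M₁] [AddCommGroup M₂] [AddCommGroup M₃]
    [AddCommGroup N₁] [AddCommGroup N₂] [AddCommGroup N₃] [Module A M₁] [Module A M₂]
    [Module A M₃] [Module A N₁] [Module A N₂] [Module A N₃] [Module B N₁] [Module B N₂]
    [Module B N₃] [IsScalarTower A B N₁] [IsScalarTower A B N₂] [IsScalarTower A B N₃]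
    {i : M₁ →ₗ[A] M₂} {p : M₂ →ₗ[A] M₃} {j : N₁ →ₗ[B] N₂} {q : N₂ →ₗ[B] N₃}
    {h₁ : M₁ →ₗ[A] N₁} {h₂ : M₂ →ₗ[A] N₂} {h₃ : M₃ →ₗ[A] N₃}
    {r : M₂ →ₗ[A] M₁} (hr : r ∘ₗ i = LinearMap.id) (hip : Function.Exact i p)
    (hp : Function.Surjective p) (hj : Function.Injective j) (hqj : ∀ n, q (j n) = 0)
    (hji : ∀ m, j (h₁ m) = h₂ (i m)) (hqp : ∀ m, q (h₂ m) = h₃ (p m))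
    (hh₂ : IsBaseChange B h₂) (hh₃ : IsBaseChange B h₃) : IsBaseChange B h₁ := by
  set l : TensorProduct A B M₁ →ₗ[A] N₁ :=
    TensorProduct.lift
      (((Algebra.linearMap B (Module.End B (M₁ →ₗ[A] N₁))).flip h₁).restrictScalars A)
    with hl
  have hlj : ∀ x, j (l x) = hh₂.equiv (i.lTensor B x) := by
    intro x
    induction x using TensorProduct.induction_on with
    | zero => simp
    | tmul b m => simp [hl, IsBaseChange.equiv_tmul, hji]
    | add x y hx hy => simp only [map_add, hx, hy]
  have hpq : ∀ x, q (hh₂.equiv x) = hh₃.equiv (p.lTensor B x) := by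
    intro x
    induction x using TensorProduct.induction_on with
    | zero => simp
    | tmul b m => simp [IsBaseChange.equiv_tmul, hqp]
    | add x y hx hy => simp only [map_add, hx, hy]
  have hinj : Function.Injective (i.lTensor B) := by
    refine Function.LeftInverse.injective (g := r.lTensor B) fun x => ?_
    rw [← LinearMap.comp_apply, ← LinearMap.lTensor_comp, hr, LinearMap.lTensor_id,
      LinearMap.id_apply]
  refine ⟨fun x y hxy => hinj (hh₂.equiv.injective ?_), fun n => ?_⟩
  · rw [← hlj, ← hlj]
    exact congrArg j hxy
  · obtain ⟨x, hx⟩ := hh₂.equiv.surjective (j n)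
    have hx0 : p.lTensor B x = 0 := by
      apply hh₃.equiv.injective
      rw [← hpq, hx, hqj, map_zero]
    obtain ⟨y, rfl⟩ := (lTensor_exact B hip hp x).1 hx0
    exact ⟨y, hj ((hlj y).trans hx)⟩

/-! ### Spectra of symmetric algebras -/

section SymmetricAlgebra

variable {A : Type u} [CommRing A]

/-- The primes of `Sym M` on the zero section of the dual bundle are those containing `M`. -/
theorem mem_range_comap_algebraMapInv_iff {M : Type u} [AddCommGroup M] [Module A M]
    (q : PrimeSpectrum (SymmetricAlgebra A M)) :
    q ∈ Set.range (PrimeSpectrum.comap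
        (SymmetricAlgebra.algebraMapInv : SymmetricAlgebra A M →ₐ[A] A).toRingHom) ↔
      ∀ m, SymmetricAlgebra.ι A M m ∈ q.asIdeal := by
  constructor
  · rintro ⟨p, rfl⟩ m
    simp [PrimeSpectrum.comap_asIdeal, SymmetricAlgebra.algebraMapInv_ι]
  · intro h
    refine ⟨PrimeSpectrum.comap (algebraMap A _) q, ?_⟩
    have hsub : ∀ z : SymmetricAlgebra A M,
        z - algebraMap A _ (SymmetricAlgebra.algebraMapInv z) ∈ q.asIdeal := by
      intro z
      induction z using SymmetricAlgebra.induction with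
      | algebraMap r => simp
      | ι x => simpa [SymmetricAlgebra.algebraMapInv_ι] using h x
      | mul a b ha hb =>
        rw [map_mul, map_mul]
        have := q.asIdeal.add_mem (q.asIdeal.mul_mem_right b ha)
          (q.asIdeal.mul_mem_left (algebraMap A _ (SymmetricAlgebra.algebraMapInv a)) hb)
        convert this using 1
        ring
      | add a b ha hb =>
        rw [map_add, map_add, add_sub_add_comm]
        exact add_mem ha hb
    ext z
    change algebraMap A _ (SymmetricAlgebra.algebraMapInv z) ∈ q.asIdeal ↔ z ∈ q.asIdeal
    exact ⟨fun h => by simpa using add_mem (hsub z) h, fun h => by simpa using sub_mem h (hsub z)⟩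

theorem flat_symmetricAlgebra (A : Type u) [CommRing A] (M : Type u) [AddCommGroup M] [Module A M]
    [Module.Projective A M] : Module.Flat A (SymmetricAlgebra A M) := by
  obtain ⟨s, hs⟩ := Module.projective_def'.1 ‹Module.Projective A M›
  let F := M →₀ A
  let f : SymmetricAlgebra A M →ₐ[A] SymmetricAlgebra A F :=
    SymmetricAlgebra.lift (SymmetricAlgebra.ι A F ∘ₗ s)
  let g : SymmetricAlgebra A F →ₐ[A] SymmetricAlgebra A M :=
    SymmetricAlgebra.lift (SymmetricAlgebra.ι A M ∘ₗ Finsupp.linearCombination A id)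
  have hgf : g.comp f = AlgHom.id A _ := by
    refine SymmetricAlgebra.algHom_ext (LinearMap.ext fun m => ?_)
    have hm : Finsupp.linearCombination A id (s m) = m := LinearMap.congr_fun hs m
    simp [f, g, hm]
  exact Module.Flat.of_retract f.toLinearMap g.toLinearMap
    (LinearMap.ext fun x => DFunLike.congr_fun hgf x)

variable {M N : Type u} [AddCommGroup M] [AddCommGroup N] [Module A M] [Module A N]

/-- Over the complement of the support of `coker d`, the dual map identifies the image of the
bundle `N^∨` in `M^∨` with the zero locus of `ker d`. At a point `q` with residue field `κ`
some `a` invertible in `κ` maps `N` into the range of `d`, so `M → κ` extends to `N` through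
`a⁻¹`. -/
theorem exists_comap_symMap_eq [Module.Finite A N] (d : M →ₗ[A] N)
    (q : PrimeSpectrum (SymmetricAlgebra A M))
    (hq : ∀ m ∈ LinearMap.ker d, SymmetricAlgebra.ι A M m ∈ q.asIdeal)
    (hU : PrimeSpectrum.comap (algebraMap A (SymmetricAlgebra A M)) q ∉
      Module.support A (N ⧸ LinearMap.range d)) :
    ∃ q' : PrimeSpectrum (SymmetricAlgebra A N), PrimeSpectrum.comap (symMap d) q' = q := by
  rw [Module.mem_support_iff_of_finite, SetLike.not_le_iff_exists] at hU
  obtain ⟨a, ha, haq⟩ := hU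
  have harange : ∀ n, a • n ∈ LinearMap.range d := fun n => by
    rw [← Submodule.Quotient.mk_eq_zero, Submodule.Quotient.mk_smul]
    exact Module.mem_annihilator.1 ha _
  let K := q.asIdeal.ResidueField
  let φ : SymmetricAlgebra A M →ₐ[A] K := IsScalarTower.toAlgHom A _ K
  have hφ : ∀ z, φ z = 0 ↔ z ∈ q.asIdeal := fun z => Ideal.algebraMap_residueField_eq_zero
  have haK : algebraMap A K a ≠ 0 := fun h => haq <| by
    rw [← φ.commutes] at h
    exact (hφ _).1 h
  let g : LinearMap.range d →ₗ[A] K :=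
    (LinearMap.ker d).liftQ (φ.toLinearMap ∘ₗ SymmetricAlgebra.ι A M)
      (fun m hm => (hφ _).2 (hq m hm)) ∘ₗ d.quotKerEquivRange.symm.toLinearMap
  have hg : ∀ m, g ⟨d m, m, rfl⟩ = φ (SymmetricAlgebra.ι A M m) := fun m => by
    have : d.quotKerEquivRange.symm ⟨d m, m, rfl⟩ = Submodule.Quotient.mk m := by
      rw [LinearEquiv.symm_apply_eq]
      rfl
    simp only [g, LinearMap.comp_apply, LinearEquiv.coe_coe, this]
    rfl
  let e : N →ₗ[A] K := LinearMap.lsmul K K (algebraMap A K a)⁻¹ ∘ₗ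
    g ∘ₗ LinearMap.codRestrict _ (LinearMap.lsmul A N a) harange
  have he : ∀ m, e (d m) = φ (SymmetricAlgebra.ι A M m) := fun m => by
    have : LinearMap.codRestrict _ (LinearMap.lsmul A N a) harange (d m) =
        a • (⟨d m, m, rfl⟩ : LinearMap.range d) := rfl
    change (algebraMap A K a)⁻¹ •
      g (LinearMap.codRestrict _ (LinearMap.lsmul A N a) harange (d m)) = _
    rw [this, map_smul, hg, ← algebraMap_smul K a, smul_smul, inv_mul_cancel₀ haK, one_smul]
  have hcomp : (SymmetricAlgebra.lift e).toRingHom.comp (symMap d) = φ.toRingHom := by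
    refine symRingHom_ext (fun b => ?_) (fun m => ?_)
    · simp
    · simp [he]
  refine ⟨PrimeSpectrum.comap (SymmetricAlgebra.lift e).toRingHom ⊥, ?_⟩
  rw [← PrimeSpectrum.comap_comp_apply, hcomp]
  ext z
  exact hφ z

/-- The zero locus of `ker d` in `M^∨` is a vector bundle, so by going down each of its points
specializes one lying over a generic point of the base. -/
theorem exists_le_minimalPrimes_of_ker_le [Module.Projective A M] (d : M →ₗ[A] N)
    [Module.Projective A (LinearMap.range d)] (q : PrimeSpectrum (SymmetricAlgebra A M))
    (hq : ∀ m ∈ LinearMap.ker d, SymmetricAlgebra.ι A M m ∈ q.asIdeal) :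
    ∃ q₀ ≤ q, (∀ m ∈ LinearMap.ker d, SymmetricAlgebra.ι A M m ∈ q₀.asIdeal) ∧
      (PrimeSpectrum.comap (algebraMap A (SymmetricAlgebra A M)) q₀).asIdeal ∈ minimalPrimes A := by
  have := flat_symmetricAlgebra A M
  obtain ⟨s, hs⟩ := Module.projective_lifting_property d.rangeRestrict LinearMap.id
    d.surjective_rangeRestrict
  -- The idempotent `e` of `M` with kernel `ker d` gives a retraction onto the zero locus.
  let e : M →ₗ[A] M := s ∘ₗ d.rangeRestrict
  have he : ∀ m, m - e m ∈ LinearMap.ker d := fun m => by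
    have : d (e m) = d m := congrArg Subtype.val (LinearMap.congr_fun hs (d.rangeRestrict m))
    rw [LinearMap.mem_ker, map_sub, this, sub_self]
  have hek : ∀ m ∈ LinearMap.ker d, e m = 0 := fun m hm => by
    have : d.rangeRestrict m = 0 := Subtype.ext hm
    simp only [e, LinearMap.comp_apply, this, map_zero]
  have hretract : PrimeSpectrum.comap (symMap e) q = q := by
    have hsub : ∀ z, symMap e z - z ∈ q.asIdeal := by
      intro z
      rw [← Ideal.Quotient.eq]
      refine DFunLike.congr_fun (f := (Ideal.Quotient.mk q.asIdeal).comp (symMap e))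
        (g := Ideal.Quotient.mk q.asIdeal) (symRingHom_ext (fun b => ?_) (fun m => ?_)) z
      · simp
      · rw [RingHom.comp_apply, symMap_ι, eq_comm, Ideal.Quotient.eq, ← map_sub]
        exact hq _ (he m)
    ext z
    change symMap e z ∈ q.asIdeal ↔ _
    rw [← Submodule.sub_mem_iff_left _ (hsub z)]
    simp
  obtain ⟨p, hp, hpq⟩ := Ideal.exists_minimalPrimes_le
    (bot_le : ⊥ ≤ q.asIdeal.comap (algebraMap A (SymmetricAlgebra A M)))
  have hpp : p.IsPrime := hp.1.1
  have : q.asIdeal.LiesOver (q.asIdeal.comap (algebraMap A (SymmetricAlgebra A M))) := ⟨rfl⟩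
  obtain ⟨Q, hQq, hQ, hQp⟩ := Ideal.exists_ideal_le_liesOver_of_le q.asIdeal hpq
  refine ⟨PrimeSpectrum.comap (symMap e) ⟨Q, hQ⟩, ?_, fun m hm => ?_, ?_⟩
  · rw [← hretract]
    exact fun z hz => hQq hz
  · change symMap e _ ∈ Q
    rw [symMap_ι, hek m hm, map_zero]
    exact Q.zero_mem
  · rw [← PrimeSpectrum.comap_comp_apply]
    have : (symMap e).comp (algebraMap A (SymmetricAlgebra A M)) = algebraMap A _ :=
      RingHom.ext fun b => symMap_algebraMap e b
    rw [this]
    change Ideal.comap _ Q ∈ _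
    have := hQp.over
    rw [Ideal.under_def] at this
    rwa [← this]

end SymmetricAlgebra

theorem notMem_support_of_mem_minimalPrimes {A : Type*} [CommRing A] {N : Type*} [AddCommGroup N]
    [Module A N] (hN : Module.IsTorsion A N) (p : PrimeSpectrum A)
    (hp : p.asIdeal ∈ minimalPrimes A) : p ∉ Module.support A N := by
  rw [Module.notMem_support_iff']
  intro n
  obtain ⟨a, ha⟩ := @hN n
  exact ⟨a, fun h => notMem_nonZeroDivisors_of_mem_mem_minimalPrimes h hp a.2, ha⟩

/-! ### Kernels of bundle homomorphisms and zero sections -/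

namespace ModuleSheaf

variable {D : Type w} [Category.{v} D] {O : D ⥤ CommRingCat.{u}}

/-- The inclusion of the kernel sheaf. -/
def kerι {E E' : ModuleSheaf O} (β : Hom E E') : Hom (ker β) E where
  app X := (LinearMap.ker (β.app X)).subtype
  naturality _ _ := rfl

/-- The projection onto the image sheaf. -/
def toImage {E E' : ModuleSheaf O} (β : Hom E E') : Hom E (image β) where
  app X := (β.app X).rangeRestrict
  naturality g m := Subtype.ext (β.naturality g m)

/-- The projection of a direct sum onto its second summand. -/
def prodSnd (E E' : ModuleSheaf O) : Hom (E.prod E') E' where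
  app _ := LinearMap.snd _ _ _
  naturality _ _ := rfl

theorem exists_retraction_kerι {E E' : ModuleSheaf O} (β : Hom E E')
    (hI : (image β).IsLocallyFree) (X : D) :
    ∃ r : E.obj X →ₗ[O.obj X] (ker β).obj X, r ∘ₗ (kerι β).app X = LinearMap.id := by
  have : Module.Projective (O.obj X) (LinearMap.range (β.app X)) := hI.projective X
  obtain ⟨s, hs⟩ := Module.projective_lifting_property (β.app X).rangeRestrict LinearMap.id
    (β.app X).surjective_rangeRestrict
  refine ⟨LinearMap.codRestrict (LinearMap.ker (β.app X))
    (LinearMap.id - s ∘ₗ (β.app X).rangeRestrict) fun m => ?_, LinearMap.ext fun m => ?_⟩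
  · have : β.app X (s ((β.app X).rangeRestrict m)) = β.app X m :=
      congrArg Subtype.val (LinearMap.congr_fun hs ((β.app X).rangeRestrict m))
    rw [LinearMap.mem_ker, LinearMap.sub_apply, map_sub, LinearMap.comp_apply, this,
      LinearMap.id_apply, sub_self]
  · have h0 : (β.app X).rangeRestrict m.1 = 0 := Subtype.ext m.2
    refine Subtype.ext ?_
    change m.1 - s ((β.app X).rangeRestrict m.1) = m.1
    rw [h0, map_zero, sub_zero]

theorem IsLocallyFree.ker {E E' : ModuleSheaf O} {β : Hom E E'} (hE : E.IsLocallyFree)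
    (hI : (image β).IsLocallyFree) : (ModuleSheaf.ker β).IsLocallyFree where
  finite X := by
    obtain ⟨r, hr⟩ := exists_retraction_kerι β hI X
    have := hE.finite X
    exact Module.Finite.of_surjective r fun m => ⟨_, LinearMap.congr_fun hr m⟩
  projective X := by
    obtain ⟨r, hr⟩ := exists_retraction_kerι β hI X
    have := hE.projective X
    exact Module.Projective.of_split _ r hr
  baseChange {X Y} g := by
    obtain ⟨r, hr⟩ := exists_retraction_kerι β hI X
    let _ : Algebra (O.obj X) (O.obj Y) := (O.map g).hom.toAlgebra
    let _ : Module (O.obj X) (E.obj Y) := Module.compHom (E.obj Y) (O.map g).hom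
    let _ : Module (O.obj X) ((ModuleSheaf.ker β).obj Y) :=
      Module.compHom ((ModuleSheaf.ker β).obj Y) (O.map g).hom
    let _ : Module (O.obj X) ((image β).obj Y) := Module.compHom ((image β).obj Y) (O.map g).hom
    have _ : IsScalarTower (O.obj X) (O.obj Y) (E.obj Y) := ⟨fun _ b m => mul_smul _ b m⟩
    have _ : IsScalarTower (O.obj X) (O.obj Y) ((ModuleSheaf.ker β).obj Y) :=
      ⟨fun _ b m => mul_smul _ b m⟩
    have _ : IsScalarTower (O.obj X) (O.obj Y) ((image β).obj Y) :=
      ⟨fun _ b m => mul_smul _ b m⟩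
    refine isBaseChange_of_split_exact (p := (toImage β).app X)
      (j := (kerι β).app Y) (q := (toImage β).app Y) hr (fun m => ?_)
      (β.app X).surjective_rangeRestrict Subtype.val_injective (fun n => Subtype.ext n.2)
      (fun _ => rfl) ((toImage β).naturality g) (hE.baseChange g)
      (hI.baseChange g)
    exact ⟨fun hm => ⟨⟨m, congrArg Subtype.val hm⟩, rfl⟩, fun ⟨n, hn⟩ => hn ▸ Subtype.ext n.2⟩

theorem dualSurjective_kerι {E E' : ModuleSheaf O} (β : Hom E E')
    (hI : (image β).IsLocallyFree) : (kerι β).DualSurjective := fun X φ => by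
  obtain ⟨r, hr⟩ := exists_retraction_kerι β hI X
  exact ⟨φ ∘ₗ r, LinearMap.ext fun m => congrArg φ (LinearMap.congr_fun hr m)⟩

/-- The zero section `M → E^∨`, given on charts by the augmentations `Sym E → O`. -/
noncomputable def zeroSectionHom (E : ModuleSheaf O) : E.dualTotal ⟶ O where
  app X := CommRingCat.ofHom (SymmetricAlgebra.algebraMapInv :
      SymmetricAlgebra (O.obj X) (E.obj X) →ₐ[O.obj X] O.obj X).toRingHom
  naturality {X Y} g := by
    ext1
    refine symRingHom_ext (fun a => ?_) (fun m => ?_)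
    · change SymmetricAlgebra.algebraMapInv (symMap (E.map g) _) =
        (O.map g).hom (SymmetricAlgebra.algebraMapInv _)
      simp
    · change SymmetricAlgebra.algebraMapInv (symMap (E.map g) _) =
        (O.map g).hom (SymmetricAlgebra.algebraMapInv _)
      simp [SymmetricAlgebra.algebraMapInv_ι]

end ModuleSheaf

namespace ClosedSubstack

variable {D : Type w} [Category.{v} D] {P : StackPresentation.{w, v, u} D}

theorem subset_closure (S : ∀ X : D, Set (PrimeSpectrum (P.atlas.obj X))) (X : D) :
    S X ⊆ (closure P S).carrier X :=
  fun _ hq => Set.mem_iInter₂.2 fun _ hZ => hZ X hq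

theorem closure_le {S : ∀ X : D, Set (PrimeSpectrum (P.atlas.obj X))} {Z : ClosedSubstack P}
    (h : ∀ X, S X ⊆ Z.carrier X) : closure P S ≤ Z :=
  fun _ => Set.biInter_subset_of_mem h

theorem cycle_eq_single (Λ : Type w') [CommRing Λ] (Z : IntegralSubstack P) :
    Z.1.cycle Λ = Finsupp.single Z 1 := by
  have hmax : ∀ W : IntegralSubstack P,
      Maximal (fun W' : ClosedSubstack P => W'.IsIrreducible ∧ W' ≤ Z.1) W.1 ↔ W = Z := by
    refine fun W => ⟨fun h => Subtype.ext (le_antisymm h.1.2 (h.2 ⟨Z.2, le_rfl⟩ h.1.2)), ?_⟩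
    rintro rfl
    exact ⟨⟨W.2, le_rfl⟩, fun _ h _ => h.2⟩
  simp only [cycle, hmax, finsum_cond_eq_left]

/-- Irreducibility of the closure of a zero section. The base `M` is irreducible, so of
two closed substacks covering the zero section one contains all of it. -/
theorem isIrreducible_of_zeroSectionPoints {O : D ⥤ CommRingCat.{u}}
    (hM : (whole (StackPresentation.ofCharts O)).IsIrreducible) (E : ModuleSheaf O)
    {rel : D ⥤ CommRingCat.{u}} (s t : E.dualTotal ⟶ rel)
    (Z : ClosedSubstack (StackPresentation.mk E.dualTotal rel s t))
    (hZ : ∀ X, E.zeroSectionPoints (fun _ => Set.univ) X ⊆ Z.carrier X)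
    (hmin : ∀ Z' : ClosedSubstack (StackPresentation.mk E.dualTotal rel s t),
      (∀ X, E.zeroSectionPoints (fun _ => Set.univ) X ⊆ Z'.carrier X) → Z ≤ Z') :
    Z.IsIrreducible := by
  obtain ⟨⟨X, p, -⟩, hirr⟩ := hM
  refine ⟨⟨X, _, hZ X ⟨p, trivial, rfl⟩⟩, fun Z₁ Z₂ h => ?_⟩
  refine (hirr (Z₁.toAtlas.preimage E.zeroSectionHom) (Z₂.toAtlas.preimage E.zeroSectionHom)
    fun Y y _ => h Y (hZ Y ⟨y, trivial, rfl⟩)).imp (fun h' => hmin _ ?_) (fun h' => hmin _ ?_)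
  all_goals
    rintro Y _ ⟨y, -, rfl⟩
    exact h' Y (Set.mem_univ y)

end ClosedSubstack

section ZeroSection

variable {D : Type w} [Category.{v} D] {O : D ⥤ CommRingCat.{u}}

/-- The zero section is already closed. Compatibility of its equations `E` with the morphisms of
charts holds because `E Y` is spanned by the image of `E X`. -/
theorem VBundle.mem_zeroSection_iff (E : VBundle O) (X : D)
    (q : PrimeSpectrum (E.1.dualTotal.obj X)) :
    q ∈ E.zeroSection.carrier X ↔
      ∀ m, SymmetricAlgebra.ι (O.obj X) (E.1.obj X) m ∈ q.asIdeal := by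
  let Z : ClosedSubstack E.total :=
    { carrier X := {q | ∀ m, SymmetricAlgebra.ι (O.obj X) (E.1.obj X) m ∈ q.asIdeal}
      isClosed X := by
        convert! PrimeSpectrum.isClosed_zeroLocus
          (Set.range (SymmetricAlgebra.ι (O.obj X) (E.1.obj X))) using 1
        ext q
        exact Set.range_subset_iff.symm
      preimage_map {X Y} g := by
        ext q
        have hmap (m) : (E.1.dualTotal.map g).hom (SymmetricAlgebra.ι (O.obj X) (E.1.obj X) m) =
            SymmetricAlgebra.ι (O.obj Y) (E.1.obj Y) (E.1.map g m) := symMap_ι _ m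
        refine ⟨fun h m => ?_, fun h m => ?_⟩
        · let _ : Algebra (O.obj X) (O.obj Y) := (O.map g).hom.toAlgebra
          let _ : Module (O.obj X) (E.1.obj Y) := Module.compHom (E.1.obj Y) (O.map g).hom
          have _ : IsScalarTower (O.obj X) (O.obj Y) (E.1.obj Y) := ⟨fun _ b m => mul_smul _ b m⟩
          refine (E.2.baseChange g).inductionOn m _ ?_ (fun n => ?_) (fun s n hn => ?_)
            fun n₁ n₂ h₁ h₂ => ?_
          · rw [map_zero]
            exact zero_mem _
          · have := h n
            rw [PrimeSpectrum.comap_asIdeal, Ideal.mem_comap, hmap] at this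
            exact this
          · rw [map_smul, Algebra.smul_def]
            exact q.asIdeal.mul_mem_left _ hn
          · rw [map_add]
            exact add_mem h₁ h₂
        · rw [PrimeSpectrum.comap_asIdeal, Ideal.mem_comap, hmap]
          exact h _
      invariant X := rfl }
  refine ⟨fun h => ClosedSubstack.closure_le (Z := Z) (fun Y y hy => ?_) X h,
    fun h => ClosedSubstack.subset_closure _ X ?_⟩
  · obtain ⟨p, -, rfl⟩ := hy
    exact (mem_range_comap_algebraMapInv_iff _).1 ⟨p, rfl⟩
  · obtain ⟨p, hp⟩ := (mem_range_comap_algebraMapInv_iff _).2 h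
    exact ⟨p, trivial, hp⟩

theorem VBundle.isIrreducible_zeroSection
    (hM : (ClosedSubstack.whole (StackPresentation.ofCharts O)).IsIrreducible) (E : VBundle O) :
    E.zeroSection.IsIrreducible :=
  ClosedSubstack.isIrreducible_of_zeroSectionPoints hM E.1 (𝟙 _) (𝟙 _) E.zeroSection
    (ClosedSubstack.subset_closure (P := E.total) (E.1.zeroSectionPoints fun _ => Set.univ))
    fun _ h => ClosedSubstack.closure_le (P := E.total)
      (S := E.1.zeroSectionPoints fun _ => Set.univ) h

end ZeroSection

/-! ### The closure of the zero section of the bundle stack -/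

namespace TwoTermComplex

variable {D : Type w} [Category.{v} D] {O : D ⥤ CommRingCat.{u}} (R : TwoTermComplex O)

/-- The zero locus of `H⁰(R)` in `R₀^∨`, as a closed substack of the bundle stack: the
translations through `d^∨` preserve it because `d` vanishes on `H⁰(R)`. -/
noncomputable def zeroLocusH0 (hH0 : R.H0.IsLocallyFree) : ClosedSubstack R.bundleStack :=
  let Z : ClosedSubstack (StackPresentation.ofCharts R.R₀.1.dualTotal) :=
    ClosedSubstack.preimage (ModuleSheaf.kerι R.d).dualMap
      (VBundle.zeroSection ⟨R.H0, hH0⟩)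
  { carrier := Z.carrier
    isClosed := Z.isClosed
    preimage_map := Z.preimage_map
    invariant X := by
      have hst : (symMap (R.source.app X)).comp (symMap ((ModuleSheaf.kerι R.d).app X)) =
          (symMap (R.target.app X)).comp (symMap ((ModuleSheaf.kerι R.d).app X)) := by
        refine symRingHom_ext (fun a => by simp) (fun m => ?_)
        simp only [RingHom.comp_apply, symMap_ι]
        exact congrArg _ (Prod.ext rfl (LinearMap.mem_ker.1 m.2).symm)
      exact congrArg (fun f => PrimeSpectrum.comap f ⁻¹'
        (VBundle.zeroSection ⟨R.H0, hH0⟩).carrier X) hst }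

theorem mem_zeroLocusH0_iff (hH0 : R.H0.IsLocallyFree) (X : D)
    (q : PrimeSpectrum (R.R₀.1.dualTotal.obj X)) :
    q ∈ (R.zeroLocusH0 hH0).carrier X ↔ ∀ m ∈ LinearMap.ker (R.d.app X),
      SymmetricAlgebra.ι (O.obj X) (R.R₀.1.obj X) m ∈ q.asIdeal := by
  refine (VBundle.mem_zeroSection_iff ⟨R.H0, hH0⟩ X _).trans (Subtype.forall.trans ?_)
  refine forall₂_congr fun m hm => ?_
  exact iff_of_eq (congrArg (· ∈ q.asIdeal)
    (symMap_ι ((ModuleSheaf.kerι R.d).app X) (⟨m, hm⟩ : LinearMap.ker (R.d.app X))))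

/-- A closed substack of the bundle stack containing the zero section over `U` contains, being
stable under translations, the image of `R₁^∨|_U` under `d^∨`. -/
theorem comap_symMap_mem {Z : ClosedSubstack R.bundleStack}
    (hZ : ∀ X, R.R₀.1.zeroSectionPoints R.vanishingOpen X ⊆ Z.carrier X) (X : D)
    (q : PrimeSpectrum (SymmetricAlgebra (O.obj X) (R.R₁.1.obj X)))
    (hq : PrimeSpectrum.comap (algebraMap (O.obj X) _) q ∈ R.vanishingOpen X) :
    PrimeSpectrum.comap (symMap (R.d.app X)) q ∈ Z.carrier X := by
  -- `σ` is the inclusion of `R₁^∨` into `R₀^∨ × R₁^∨` by `f ↦ (0, f)`; it maps to the zero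
  -- section under the projection, and to `d^∨ f` under the action.
  let σ := symMap ((ModuleSheaf.prodSnd R.R₀.1 R.R₁.1).app X)
  have hs : σ.comp (symMap (R.source.app X)) = (algebraMap (O.obj X) _).comp
      (SymmetricAlgebra.algebraMapInv : SymmetricAlgebra (O.obj X) (R.R₀.1.obj X) →ₐ[O.obj X]
        O.obj X).toRingHom := by
    refine symRingHom_ext (fun a => by simp [σ]) (fun m => ?_)
    simp only [σ, RingHom.comp_apply, symMap_ι]
    refine (map_zero (SymmetricAlgebra.ι (O.obj X) (R.R₁.1.obj X))).trans ?_
    exact ((congrArg (algebraMap (O.obj X) _)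
      (SymmetricAlgebra.algebraMapInv_ι (R := O.obj X) m)).trans (map_zero _)).symm
  have ht : σ.comp (symMap (R.target.app X)) = symMap (R.d.app X) := by
    refine symRingHom_ext (fun a => by simp [σ]) (fun m => ?_)
    simp only [σ, RingHom.comp_apply, symMap_ι]
    rfl
  have hsZ : PrimeSpectrum.comap (symMap (R.source.app X)) (PrimeSpectrum.comap σ q) ∈
      Z.carrier X := by
    rw [← PrimeSpectrum.comap_comp_apply, hs]
    exact hZ X ⟨_, hq, rfl⟩
  have htZ : PrimeSpectrum.comap (symMap (R.target.app X)) (PrimeSpectrum.comap σ q) ∈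
      Z.carrier X := (Set.ext_iff.1 (Z.invariant X) (PrimeSpectrum.comap σ q)).1 hsZ
  rwa [← PrimeSpectrum.comap_comp_apply, ht] at htZ

theorem zeroLocusH0_le (hH0 : R.H0.IsLocallyFree)
    (htors : ∀ X, Module.IsTorsion (O.obj X) (R.H1 X))
    (himage : (ModuleSheaf.image R.d).IsLocallyFree) {Z : ClosedSubstack R.bundleStack}
    (hZ : ∀ X, R.R₀.1.zeroSectionPoints R.vanishingOpen X ⊆ Z.carrier X) :
    R.zeroLocusH0 hH0 ≤ Z := by
  intro X q hq
  have := R.R₀.2.projective X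
  have := R.R₁.2.finite X
  have : Module.Projective (O.obj X) (LinearMap.range (R.d.app X)) := himage.projective X
  obtain ⟨q₀, hq₀, hker, hmin⟩ := exists_le_minimalPrimes_of_ker_le (R.d.app X) q
    ((R.mem_zeroLocusH0_iff hH0 X q).1 hq)
  have hU := notMem_support_of_mem_minimalPrimes (htors X) _ hmin
  obtain ⟨q₁, rfl⟩ := exists_comap_symMap_eq (R.d.app X) q₀ hker hU
  have hsp := (PrimeSpectrum.le_iff_specializes _ _).1 hq₀
  refine hsp.mem_closed (Z.isClosed X) (R.comap_symMap_mem hZ X q₁ ?_)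
  rw [← PrimeSpectrum.comap_comp_apply] at hU
  have : (symMap (R.d.app X)).comp (algebraMap (O.obj X) _) = algebraMap (O.obj X) _ :=
    RingHom.ext fun b => symMap_algebraMap _ b
  rwa [this] at hU

theorem zeroSectionPoints_subset_zeroLocusH0 (hH0 : R.H0.IsLocallyFree)
    (U : ∀ X, Set (PrimeSpectrum (O.obj X))) (X : D) :
    R.R₀.1.zeroSectionPoints U X ⊆ (R.zeroLocusH0 hH0).carrier X := by
  rintro _ ⟨p, -, rfl⟩
  exact (R.mem_zeroLocusH0_iff hH0 X _).2 fun m _ =>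
    (mem_range_comap_algebraMapInv_iff _).1 ⟨p, rfl⟩ m

theorem zeroClosure_eq (hH0 : R.H0.IsLocallyFree)
    (htors : ∀ X, Module.IsTorsion (O.obj X) (R.H1 X))
    (himage : (ModuleSheaf.image R.d).IsLocallyFree) : R.zeroClosure = R.zeroLocusH0 hH0 :=
  le_antisymm (ClosedSubstack.closure_le (R.zeroSectionPoints_subset_zeroLocusH0 hH0 _))
    (R.zeroLocusH0_le hH0 htors himage
      (ClosedSubstack.subset_closure (P := R.bundleStack)
        (R.R₀.1.zeroSectionPoints R.vanishingOpen)))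

theorem isIrreducible_zeroLocusH0 (hH0 : R.H0.IsLocallyFree)
    (hM : (ClosedSubstack.whole (StackPresentation.ofCharts O)).IsIrreducible)
    (htors : ∀ X, Module.IsTorsion (O.obj X) (R.H1 X))
    (himage : (ModuleSheaf.image R.d).IsLocallyFree) : (R.zeroLocusH0 hH0).IsIrreducible :=
  ClosedSubstack.isIrreducible_of_zeroSectionPoints hM R.R₀.1 _ _ _
    (R.zeroSectionPoints_subset_zeroLocusH0 hH0 _) fun _ hZ =>
      R.zeroLocusH0_le hH0 htors himage fun X =>
        (Set.image_mono (Set.subset_univ _)).trans (hZ X)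

end TwoTermComplex

theorem mainTheorem6 {k : Type u} [Field k] (M : PseudofunctorOverField.{w', v'} k)
    [IsDeligneMumford M] (hM : IsIntegralStack M) (Λ : Type w) [CommRing Λ]
    (R : TwoTermComplex (structureSheafOf M))
    (htors : ∀ X, Module.IsTorsion ((structureSheafOf M).obj X) (R.H1 X))
    (himage : (ModuleSheaf.image R.d).IsLocallyFree) :
    ∃ hH0 : R.H0.IsLocallyFree,
      R.gysin Λ (R.zeroClosure.cycle Λ) = eulerClassDual Λ ⟨R.H0, hH0⟩ := by
  have hH0 : R.H0.IsLocallyFree := R.R₀.2.ker himage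
  refine ⟨hH0, ?_⟩
  have hB := R.isIrreducible_zeroLocusH0 hH0 hM.irreducible htors himage
  have h0 := VBundle.isIrreducible_zeroSection hM.irreducible ⟨R.H0, hH0⟩
  rw [R.zeroClosure_eq hH0 htors himage, ClosedSubstack.cycle_eq_single Λ ⟨_, hB⟩, eulerClassDual,
    ClosedSubstack.cycle_eq_single Λ ⟨_, h0⟩, TwoTermComplex.gysin,
    Finsupp.linearCombination_single, one_smul, eq_comm]
  -- Both sides are now the classes of the zero section of `H⁰(R)^∨` and of its flat pullback to
  -- `R₀^∨`, which are identified in the Chow group.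
  exact (Submodule.Quotient.eq _).2 (Submodule.subset_span (Or.inr
    ⟨⟨R.H0, hH0⟩, R.R₀, ModuleSheaf.kerι R.d, ModuleSheaf.dualSurjective_kerι R.d himage,
      ⟨_, h0⟩, rfl⟩))
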